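/- Consider the income fluctuation problem: maximize $\mathrm{E}_0\sum_{t=0}^\infty \beta^t u(c_t)$ subject to $a_{t+1}=R(a_t-c_t)+y_{t+1}$ and $0\le c_t\le a_t$, with initial wealth $a_0=a>0$ and initial state $z_0=z$ given, where $c_t$ is a measurable function of $(z_0,\dots,z_t)$. Assume: (1) $u:[0,\infty)\to\{-\infty\}\cup\mathbb{R}$ is finite and twice continuously differentiable on $(0,\infty)$ with $u'>0$, $u''<0$, $u'(x)\to\infty$ as $x\downarrow 0$, $u'(x)\to 0$ as $x\to\infty$, and $u(0)\le u(x)$ for $x>0$; (2) $y_t=y(z_t)\ge 0$, where $\{z_t\}$ is a time-homogeneous Markov process on a measurable space $Z$ and $\sup_{z\in Z}\mathrm{E}[y(z_{t+1})\mid z_t=z]<\infty$; (3) $\bar\gamma:=\limsup_{x\to\infty}\bigl(-xu''(x)/u'(x)\bigr)<\infty$; (4) $\beta>0$ and $1\le R<1/\beta$. Let $c(a,z)$ be an optimal consumption rule, that is, a measurable function with $0\le c(a,z)\le a$ such that for every $a>0$ and $z\in Z$ the plan $c_t=c(a_t,z_t)$ attains the maximum in the problem started at $(a,z)$, and this maximum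 is not $-\infty$. If $R=1$, assume in addition that $\inf_{z\in Z}c(a,z)>0$ for some $a>0$. Then for every $m\in\bigl(1-1/R,\;1-\beta^{1/\bar\gamma}R^{1/\bar\gamma-1}\bigr)$, where the upper endpoint is read as $1$ if $\bar\gamma=0$, there exists $A\ge 0$ such that $$c(a,z)\ge ma\qquad\text{for all } a\ge A \text{ and all } z\in Z .$$ -/

import Mathlib

open Set Filter Topology MeasureTheory ProbabilityTheory
open scoped ENNReal NNReal

noncomputable section

namespace IncomeFluctuation

/-- The real-valued restriction of a utility function `u : ℝ₊ → {-∞} ∪ ℝ`. Only its values and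
derivatives on `(0, ∞)` matter, where `u` is finite. -/
def realUtility (u : ℝ → EReal) (x : ℝ) : ℝ := (u x).toReal

/-- Marginal utility `u'` (on `(0, ∞)`). -/
def marginalUtility (u : ℝ → EReal) : ℝ → ℝ := deriv (realUtility u)

/-- The second derivative `u''` (on `(0, ∞)`). -/
def marginalUtility' (u : ℝ → EReal) : ℝ → ℝ := deriv (marginalUtility u)

/-- A utility function `u : [0, ∞) → {-∞} ∪ ℝ`, finite, twice continuously differentiable, strictly
increasing and strictly concave on `(0, ∞)`, with `u'(0) = ∞` and `u'(∞) = 0`. Consuming nothing is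
never better than consuming something. Values at negative arguments are irrelevant. -/
structure UtilityAssumption (u : ℝ → EReal) : Prop where
  ne_top : ∀ x, 0 < x → u x ≠ ⊤
  ne_bot : ∀ x, 0 < x → u x ≠ ⊥
  zero_le : ∀ x, 0 < x → u 0 ≤ u x
  contDiffOn : ContDiffOn ℝ 2 (realUtility u) (Ioi 0)
  deriv_pos : ∀ x, 0 < x → 0 < marginalUtility u x
  deriv2_neg : ∀ x, 0 < x → marginalUtility' u x < 0
  deriv_zero : Tendsto (marginalUtility u) (𝓝[>] 0) atTop
  deriv_infty : Tendsto (marginalUtility u) atTop (𝓝 0)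

/-- The local relative risk aversion coefficient `γ(x) = -x u''(x) / u'(x)`. -/
def relativeRiskAversion (u : ℝ → EReal) (x : ℝ) : ℝ :=
  -(x * marginalUtility' u x / marginalUtility u x)

/-- Bounded relative risk aversion: `limsup_{x → ∞} γ(x) < ∞`. -/
def BoundedRelativeRiskAversion (u : ℝ → EReal) : Prop :=
  IsBoundedUnder (· ≤ ·) atTop (relativeRiskAversion u)

/-- The asymptotic relative risk aversion coefficient `γ̄ = limsup_{x → ∞} γ(x)`. -/
def asymptoticRRA (u : ℝ → EReal) : ℝ := limsup (relativeRiskAversion u) atTop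

/-- The number `1 - β^{1/γ} R^{1/γ - 1} = 1 - (β R)^{1/γ} / R`. For `γ = 0` it is `1`, because
`1/γ = ∞` and `(β R)^∞ = 0` when `0 < β R < 1`. -/
def upperPropensity (β R γ : ℝ) : ℝ :=
  if γ = 0 then 1 else 1 - β ^ (1 / γ) * R ^ (1 / γ - 1)

variable {Z : Type*} [MeasurableSpace Z]

/-- The income process `y_t = y(z_t)`, where `z_t` is a Markov process with transition kernel `κ`:
income is nonnegative, with `sup_z E[y(z_{t+1}) | z_t = z] < ∞`. -/
structure IncomeAssumption (κ : Kernel Z Z) (y : Z → ℝ) : Prop where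
  measurable : Measurable y
  nonneg : ∀ z, 0 ≤ y z
  bounded_mean : ∃ B : ℝ, ∀ z, ∫⁻ z', ENNReal.ofReal (y z') ∂(κ z) ≤ ENNReal.ofReal B

/-- The transition of the Markov process given the history `(z_0, …, z_n)`: only the last state
matters. -/
def historyKernel (κ : Kernel Z Z) (n : ℕ) : Kernel (Π _ : Finset.Iic n, Z) Z :=
  κ.comap (fun h => h ⟨n, Finset.mem_Iic.2 le_rfl⟩) (measurable_pi_apply _)

instance (κ : Kernel Z Z) [IsMarkovKernel κ] (n : ℕ) : IsMarkovKernel (historyKernel κ n) := by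
  unfold historyKernel; infer_instance

/-- The law on path space `ℕ → Z` of the Markov process `(z_t)` with transition kernel `κ` started
at `z_0 = z`. -/
def pathLaw (κ : Kernel Z Z) [IsMarkovKernel κ] (z : Z) : Measure (ℕ → Z) :=
  Kernel.traj (X := fun _ => Z) (historyKernel κ) 0 (fun _ => z)

/-- Wealth `a_t` generated by the consumption plan `C` from the initial wealth `a`:
`a_{t+1} = R (a_t - c_t) + y(z_{t+1})`. -/
def wealth (R : ℝ) (y : Z → ℝ) (a : ℝ) (C : ℕ → (ℕ → Z) → ℝ) : ℕ → (ℕ → Z) → ℝ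
  | 0, _ => a
  | t + 1, ω => R * (wealth R y a C t ω - C t ω) + y (ω (t + 1))

/-- A feasible consumption plan from the initial wealth `a`: `c_t` is a measurable function of
`(z_0, …, z_t)`, and `0 ≤ c_t ≤ a_t`. -/
structure IsFeasiblePlan (R : ℝ) (y : Z → ℝ) (a : ℝ) (C : ℕ → (ℕ → Z) → ℝ) : Prop where
  adapted : ∀ t, Measurable[Filtration.piLE (X := fun _ => Z) t] (C t)
  nonneg : ∀ t ω, 0 ≤ C t ω
  le_wealth : ∀ t ω, C t ω ≤ wealth R y a C t ω

/-- Expected lifetime utility `E_0 ∑ₜ β^t u(c_t) ∈ [-∞, ∞]`, the total expected discounted positive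
part minus the total expected discounted negative part (`-∞` should both be infinite). -/
def lifetimeUtility (u : ℝ → EReal) (β : ℝ) (P : Measure (ℕ → Z)) (C : ℕ → (ℕ → Z) → ℝ) : EReal :=
  ((∑' t, ENNReal.ofReal (β ^ t) * ∫⁻ ω, (u (C t ω)).toENNReal ∂P : ℝ≥0∞) : EReal) -
    ((∑' t, ENNReal.ofReal (β ^ t) * ∫⁻ ω, (-u (C t ω)).toENNReal ∂P : ℝ≥0∞) : EReal)

/-- Wealth generated by the consumption policy `c(a, z)` from the initial wealth `a`. -/
def policyWealth (R : ℝ) (y : Z → ℝ) (c : ℝ → Z → ℝ) (a : ℝ) : ℕ → (ℕ → Z) → ℝ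
  | 0, _ => a
  | t + 1, ω => R * (policyWealth R y c a t ω - c (policyWealth R y c a t ω) (ω t)) + y (ω (t + 1))

/-- The consumption plan `c_t = c(a_t, z_t)` generated by the policy `c` from the initial
wealth `a`. -/
def policyPlan (R : ℝ) (y : Z → ℝ) (c : ℝ → Z → ℝ) (a : ℝ) (t : ℕ) (ω : ℕ → Z) : ℝ :=
  c (policyWealth R y c a t ω) (ω t)

/-- `c` is an optimal consumption rule of the income fluctuation problem: a measurable policy with
`0 ≤ c(a, z) ≤ a` such that, for every initial wealth `a > 0` and every initial state `z`, the
generated plan attains the maximum of expected lifetime utility over all feasible plans, and the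
maximum is not `-∞`. Values of `c` at negative wealth are irrelevant. -/
structure IsOptimalPolicy (u : ℝ → EReal) (β R : ℝ) (κ : Kernel Z Z) [IsMarkovKernel κ]
    (y : Z → ℝ) (c : ℝ → Z → ℝ) : Prop where
  measurable : Measurable (Function.uncurry c)
  nonneg : ∀ a z, 0 ≤ a → 0 ≤ c a z
  le_wealth : ∀ a z, 0 ≤ a → c a z ≤ a
  value_ne_bot : ∀ a z, 0 < a →
    lifetimeUtility u β (pathLaw κ z) (policyPlan R y c a) ≠ ⊥
  optimal : ∀ a z, 0 < a → ∀ C, IsFeasiblePlan R y a C →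
    lifetimeUtility u β (pathLaw κ z) C ≤ lifetimeUtility u β (pathLaw κ z) (policyPlan R y c a)

end IncomeFluctuation

end

/-! Suppose wealth `b` is large and consumption is at most `M`. If `β R < lam ^ γ`, where `γ` bounds
relative risk aversion at the relevant levels, then `β R u'(lam M) ≤ β R lam ^ (-γ) u'(M) < u'(M)`.
By the Euler inequality (`exists_lt_of_marginalUtility_lt`) consumption tomorrow cannot be at least
`lam M` in every state, so some successor state has consumption below `lam M` and wealth at least `R
(b - M)`. Iterating, consumption along this branch is at most `lam ^ n M`, whose present value is `M
/ (1 - lam / R)`. If `b` exceeds this present value by `A`, wealth on the branch stays above `A`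
while consumption tends to `0`. This is impossible (`lt_of_le_sub`) once consumption is bounded
below on all wealth levels above `A`. Taking `M = m a`, the excess grows linearly in `a` when `lam <
R (1 - m)`. Such a `lam` exists for `m` below the upper endpoint, and `m > 1 - 1 / R` makes `lam <
1`.

The missing ingredient is that consumption tends to infinity uniformly in the state.
`exists_forall_le` derives this from a positive uniform lower bound at one wealth level, again by
the Euler inequality. For `R > 1` such a bound follows from concavity of the value and from
consuming interest; for `R = 1` there is no interest, and the bound is assumed.

All facts about the policy come from comparing whole plans; no Bellman equation is used. -/

noncomputable section

namespace IncomeFluctuation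

/-! ### Tangents, concavity and growth of utility. -/

namespace UtilityAssumption

variable {u : ℝ → EReal} (hu : UtilityAssumption u)
include hu

lemma zero_ne_top : u 0 ≠ ⊤ := fun h =>
  hu.ne_top 1 one_pos (top_le_iff.1 (h ▸ hu.zero_le 1 one_pos))

lemma ne_top_of_nonneg {x : ℝ} (hx : 0 ≤ x) : u x ≠ ⊤ := by
  rcases hx.eq_or_lt with rfl | h
  · exact hu.zero_ne_top
  · exact hu.ne_top x h

lemma coe_realUtility {x : ℝ} (hx : 0 ≤ x) (h : u x ≠ ⊥) : ((realUtility u x : ℝ) : EReal) = u x :=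
  EReal.coe_toReal (hu.ne_top_of_nonneg hx) h

lemma coe_realUtility_of_pos {x : ℝ} (hx : 0 < x) : ((realUtility u x : ℝ) : EReal) = u x :=
  hu.coe_realUtility hx.le (hu.ne_bot x hx)

lemma hasDerivAt {x : ℝ} (hx : 0 < x) : HasDerivAt (realUtility u) (marginalUtility u x) x :=
  ((hu.contDiffOn.contDiffAt (Ioi_mem_nhds hx)).differentiableAt (by norm_num)).hasDerivAt

lemma hasDerivAt_marginalUtility {x : ℝ} (hx : 0 < x) :
    HasDerivAt (marginalUtility u) (marginalUtility' u x) x := by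
  have h : ContDiffOn ℝ 1 (deriv (realUtility u)) (Ioi 0) :=
    hu.contDiffOn.deriv_of_isOpen isOpen_Ioi (by norm_num)
  exact ((h.contDiffAt (Ioi_mem_nhds hx)).differentiableAt (by norm_num)).hasDerivAt

lemma continuousAt_marginalUtility {x : ℝ} (hx : 0 < x) : ContinuousAt (marginalUtility u) x :=
  (hu.hasDerivAt_marginalUtility hx).continuousAt

lemma strictAntiOn_marginalUtility : StrictAntiOn (marginalUtility u) (Ioi 0) := by
  refine strictAntiOn_of_deriv_neg (convex_Ioi 0)
    (fun x hx => (hu.continuousAt_marginalUtility hx).continuousWithinAt) ?_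
  intro x hx
  rw [interior_Ioi] at hx
  exact hu.deriv2_neg x hx

lemma le_tangent_of_pos {w v : ℝ} (hw : 0 < w) (hv : 0 < v) :
    realUtility u v ≤ realUtility u w + marginalUtility u w * (v - w) := by
  have hcont : ∀ {a b : ℝ}, 0 < a → ContinuousOn (realUtility u) (Icc a b) := fun ha x hx =>
    (hu.hasDerivAt (ha.trans_le hx.1)).continuousAt.continuousWithinAt
  rcases lt_trichotomy v w with h | rfl | h
  · obtain ⟨ξ, hξ, e⟩ := exists_hasDerivAt_eq_slope (realUtility u) (marginalUtility u) h
      (hcont hv) (fun x hx => hu.hasDerivAt (hv.trans hx.1))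
    have := hu.strictAntiOn_marginalUtility (mem_Ioi.2 (hv.trans hξ.1)) (mem_Ioi.2 hw) hξ.2
    rw [eq_div_iff (by linarith)] at e
    nlinarith
  · simp
  · obtain ⟨ξ, hξ, e⟩ := exists_hasDerivAt_eq_slope (realUtility u) (marginalUtility u) h
      (hcont hw) (fun x hx => hu.hasDerivAt (hw.trans hx.1))
    have := hu.strictAntiOn_marginalUtility (mem_Ioi.2 hw) (mem_Ioi.2 (hw.trans hξ.1)) hξ.1
    rw [eq_div_iff (by linarith)] at e
    nlinarith

lemma realUtility_zero_le (h0 : u 0 ≠ ⊥) {x : ℝ} (hx : 0 < x) :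
    realUtility u 0 ≤ realUtility u x :=
  EReal.toReal_le_toReal (hu.zero_le x hx) h0 (hu.ne_top x hx)

/-- Utility lies below its tangents. -/
lemma le_tangent {w v : ℝ} (hw : 0 < w) (hv : 0 ≤ v) (hb : u v ≠ ⊥) :
    realUtility u v ≤ realUtility u w + marginalUtility u w * (v - w) := by
  rcases hv.eq_or_lt with rfl | hv
  -- Utility may jump at `0`, so continuity is not available; `u 0 ≤ u δ` and the limit `δ → 0`
  -- suffice.
  · have hlim : Tendsto (fun δ : ℝ => realUtility u w + marginalUtility u w * (δ - w)) (𝓝[>] 0)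
        (𝓝 (realUtility u w + marginalUtility u w * (0 - w))) :=
      (Continuous.tendsto (by fun_prop) 0).mono_left nhdsWithin_le_nhds
    refine ge_of_tendsto hlim ?_
    filter_upwards [self_mem_nhdsWithin] with δ hδ
    exact (hu.realUtility_zero_le hb hδ).trans (hu.le_tangent_of_pos hw hδ)
  · exact hu.le_tangent_of_pos hw hv

/-- Average the tangent inequalities at the mean: the slope terms cancel. A mean of `0` has no
tangent, but then both points are `0`. -/
lemma concave_le {x y p q : ℝ} (hx : 0 ≤ x) (hy : 0 ≤ y) (hxb : u x ≠ ⊥) (hyb : u y ≠ ⊥)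
    (hp : 0 < p) (hq : 0 < q) (hpq : p + q = 1) :
    ((p * realUtility u x + q * realUtility u y : ℝ) : EReal) ≤ u (p * x + q * y) := by
  have hw0 : 0 ≤ p * x + q * y := by positivity
  rcases hw0.eq_or_lt with hw | hw
  · have hx0 : x = 0 := by
      by_contra h
      have : 0 < x := lt_of_le_of_ne hx (Ne.symm h)
      have : 0 < p * x := by positivity
      nlinarith [mul_nonneg hq.le hy]
    have hy0 : y = 0 := by
      by_contra h
      have : 0 < y := lt_of_le_of_ne hy (Ne.symm h)
      have : 0 < q * y := by positivity
      nlinarith [mul_nonneg hp.le hx]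
    subst hx0 hy0
    rw [← add_mul, hpq, one_mul]
    simp [hu.coe_realUtility le_rfl hxb]
  · rw [← hu.coe_realUtility_of_pos hw, EReal.coe_le_coe_iff]
    have h1 := mul_le_mul_of_nonneg_left (hu.le_tangent hw hx hxb) hp.le
    have h2 := mul_le_mul_of_nonneg_left (hu.le_tangent hw hy hyb) hq.le
    have e : p * (realUtility u (p * x + q * y) + marginalUtility u (p * x + q * y) *
        (x - (p * x + q * y))) + q * (realUtility u (p * x + q * y) +
        marginalUtility u (p * x + q * y) * (y - (p * x + q * y)))
        = realUtility u (p * x + q * y) := by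
      obtain rfl : q = 1 - p := by linarith
      ring
    linarith

/-- Utility has at most linear growth. -/
lemma toENNReal_le {x : ℝ} (hx : 0 ≤ x) :
    (u x).toENNReal ≤ ENNReal.ofReal |realUtility u 1| +
      ENNReal.ofReal (marginalUtility u 1) * ENNReal.ofReal x := by
  by_cases hb : u x = ⊥
  · simp [hb]
  · rw [← hu.coe_realUtility hx hb, EReal.real_coe_toENNReal,
      ← ENNReal.ofReal_mul (hu.deriv_pos 1 one_pos).le,
      ← ENNReal.ofReal_add (abs_nonneg _) (mul_nonneg (hu.deriv_pos 1 one_pos).le hx)]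
    apply ENNReal.ofReal_le_ofReal
    have := hu.le_tangent one_pos hx hb
    have := hu.deriv_pos 1 one_pos
    have := le_abs_self (realUtility u 1)
    nlinarith

/-- With relative risk aversion below `γ` on `[x₀, ∞)`, marginal utility decays at most like
`x ^ (-γ)` there. -/
lemma rpow_mul_marginalUtility_le {γ x₀ : ℝ} (hx₀ : 0 < x₀)
    (hγ : ∀ x, x₀ ≤ x → relativeRiskAversion u x ≤ γ) {x y : ℝ} (hx : x₀ ≤ x) (hxy : x ≤ y) :
    x ^ γ * marginalUtility u x ≤ y ^ γ * marginalUtility u y := by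
  have hd : ∀ w, 0 < w → HasDerivAt (fun w => w ^ γ * marginalUtility u w)
      (γ * w ^ (γ - 1) * marginalUtility u w + w ^ γ * marginalUtility' u w) w := fun w hw =>
    (Real.hasDerivAt_rpow_const (Or.inl hw.ne')).mul (hu.hasDerivAt_marginalUtility hw)
  have hmono : MonotoneOn (fun w => w ^ γ * marginalUtility u w) (Ici x₀) := by
    refine monotoneOn_of_deriv_nonneg (convex_Ici x₀)
      (fun w hw => (hd w (hx₀.trans_le hw)).continuousAt.continuousWithinAt)
      (fun w hw => ?_) (fun w hw => ?_)
    · rw [interior_Ici] at hw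
      exact (hd w (hx₀.trans hw)).differentiableAt.differentiableWithinAt
    · rw [interior_Ici] at hw
      have hw0 : 0 < w := hx₀.trans hw
      -- The derivative is `w ^ (γ - 1) u'(w)` times `γ` minus the relative risk aversion at `w`.
      rw [(hd w hw0).deriv]
      have hm := hu.deriv_pos w hw0
      have h1 := hγ w (le_of_lt hw)
      rw [relativeRiskAversion, ← neg_div, div_le_iff₀ hm] at h1
      have h2 : w ^ γ = w ^ (γ - 1) * w := by
        rw [Real.rpow_sub_one hw0.ne', div_mul_cancel₀ _ hw0.ne']
      rw [h2]
      have h3 : 0 < w ^ (γ - 1) := Real.rpow_pos_of_pos hw0 _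
      nlinarith
  exact hmono hx (hx.trans hxy) hxy

lemma relativeRiskAversion_nonneg {x : ℝ} (hx : 0 < x) : 0 ≤ relativeRiskAversion u x := by
  rw [relativeRiskAversion, ← neg_div, ← mul_neg]
  exact div_nonneg (mul_nonneg hx.le (neg_nonneg.2 (hu.deriv2_neg x hx).le)) (hu.deriv_pos x hx).le

/-- Nothing is assumed about `u` at negative arguments, so `u` itself need not be measurable. -/
lemma exists_measurable_eq : ∃ v : ℝ → EReal, Measurable v ∧ ∀ x, 0 ≤ x → v x = u x := by
  classical
  refine ⟨(Ioi (0 : ℝ)).piecewise (fun x => ((realUtility u x : ℝ) : EReal)) (fun _ => u 0), ?_, ?_⟩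
  · have : ContinuousOn (fun x => ((realUtility u x : ℝ) : EReal)) (Ioi 0) :=
      continuous_coe_real_ereal.comp_continuousOn hu.contDiffOn.continuousOn
    exact this.measurable_piecewise continuousOn_const measurableSet_Ioi
  · intro x hx
    rcases hx.eq_or_lt with rfl | h
    · simp
    · simp [h, hu.coe_realUtility_of_pos h]

end UtilityAssumption

/-! ### Path space and the law of the Markov process. -/

variable {Z : Type*}

/-- The path `ω` with its initial state replaced by `z`. -/
def pinStart (z : Z) (ω : ℕ → Z) : ℕ → Z := Function.update ω 0 z

@[simp] lemma pinStart_zero (z : Z) (ω : ℕ → Z) : pinStart z ω 0 = z := by simp [pinStart]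

@[simp] lemma pinStart_succ (z : Z) (ω : ℕ → Z) (t : ℕ) :
    pinStart z ω (t + 1) = ω (t + 1) := by simp [pinStart]

lemma wealth_eq_policyWealth (R : ℝ) (y : Z → ℝ) (c : ℝ → Z → ℝ) (a : ℝ) (t : ℕ) :
    wealth R y a (policyPlan R y c a) t = policyWealth R y c a t := by
  induction t with
  | zero => rfl
  | succ t ih =>
    ext ω
    simp only [wealth, policyWealth, ih, policyPlan]

variable [MeasurableSpace Z]

instance (κ : Kernel Z Z) [IsMarkovKernel κ] (z : Z) : IsProbabilityMeasure (pathLaw κ z) := by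
  unfold pathLaw; infer_instance

lemma measurable_pinStart (z : Z) : Measurable (pinStart z) := by
  unfold pinStart
  exact measurable_update_left

lemma measurable_piLE_apply {s t : ℕ} (h : s ≤ t) :
    Measurable[Filtration.piLE (X := fun _ => Z) t] (fun ω : ℕ → Z => ω s) := by
  have : (fun ω : ℕ → Z => ω s) = (fun v : (Π _ : Set.Iic t, Z) => v ⟨s, h⟩) ∘
      Preorder.restrictLe t := rfl
  rw [this]
  exact (measurable_pi_apply _).comp (comap_measurable _)

lemma measurable_piLE_pinStart (z : Z) (t : ℕ) :
    Measurable[Filtration.piLE (X := fun _ => Z) t, Filtration.piLE (X := fun _ => Z) t]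
      (pinStart z) := by
  refine measurable_comap_iff.2 ?_
  refine @measurable_pi_lambda _ _ _ (Filtration.piLE (X := fun _ => Z) t) _ _ fun s => ?_
  rcases s with ⟨_ | s, hs⟩
  · simp [Preorder.restrictLe]
  · simpa [Function.comp_def, Preorder.restrictLe] using measurable_piLE_apply hs

/-- The process starts at `z`, so overwriting the initial state by `z` changes nothing in law. This
replaces the statement that `ω 0 = z` almost surely, which is awkward because `{z}` need not be
measurable. -/
lemma measurePreserving_pinStart (κ : Kernel Z Z) [IsMarkovKernel κ] (z : Z) :
    MeasurePreserving (pinStart z) (pathLaw κ z) (pathLaw κ z) := by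
  refine ⟨measurable_pinStart z, ?_⟩
  have : pinStart z = fun ω => Function.updateFinset ω (Finset.Iic 0) (fun _ => z) := by
    ext ω t
    rcases t with _ | t <;> simp [Function.updateFinset]
  rw [this]
  exact Kernel.traj_map_updateFinset (X := fun _ => Z) (κ := historyKernel κ) (n := 0) (fun _ => z)

lemma lintegral_pathLaw_succ (κ : Kernel Z Z) [IsMarkovKernel κ] (z : Z) (t : ℕ)
    {f : Z → ℝ≥0∞} (hf : Measurable f) :
    ∫⁻ ω, f (ω (t + 1)) ∂pathLaw κ z = ∫⁻ ω, ∫⁻ z', f z' ∂κ (ω t) ∂pathLaw κ z := by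
  have h := Kernel.partialTraj_compProd_eq_map_traj (X := fun _ => Z) (κ := historyKernel κ)
    (Nat.zero_le t) (x₀ := fun _ => z)
  have h1 : ∫⁻ ω, f (ω (t + 1)) ∂pathLaw κ z =
      ∫⁻ p, f p.2 ∂(Kernel.traj (X := fun _ => Z) (historyKernel κ) 0 (fun _ => z)).map
        (fun x => (Preorder.frestrictLe t x, x (t + 1))) := by
    rw [lintegral_map (by fun_prop) (by fun_prop)]
    rfl
  rw [h1, ← h, Measure.lintegral_compProd (by fun_prop),
    ← Kernel.traj_map_frestrictLe_apply (X := fun _ => Z) (κ := historyKernel κ) 0 t,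
    lintegral_map ?_ (by fun_prop)]
  · rfl
  · exact (hf.comp measurable_snd).lintegral_kernel_prod_right'

/-- The measure on dates and paths that weights date `t` by `β ^ t`. -/
def discountedLaw (β : ℝ) (κ : Kernel Z Z) [IsMarkovKernel κ] (z : Z) : Measure (ℕ × (ℕ → Z)) :=
  Measure.sum fun t => ENNReal.ofReal (β ^ t) • (pathLaw κ z).map (Prod.mk t)

/-! ### Integration over dates and paths jointly. -/

section DiscountedLaw

variable (β : ℝ) (κ : Kernel Z Z) [IsMarkovKernel κ] (z : Z)

lemma lintegral_discountedLaw {f : ℕ × (ℕ → Z) → ℝ≥0∞} (hf : Measurable f) :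
    ∫⁻ p, f p ∂discountedLaw β κ z =
      ∑' t, ENNReal.ofReal (β ^ t) * ∫⁻ ω, f (t, ω) ∂pathLaw κ z := by
  rw [discountedLaw, lintegral_sum_measure]
  congr 1 with t
  rw [lintegral_smul_measure, lintegral_map hf measurable_prodMk_left, smul_eq_mul]

lemma discountedLaw_slice (n : ℕ) :
    discountedLaw β κ z ({n} ×ˢ univ) = ENNReal.ofReal (β ^ n) := by
  have hms : MeasurableSet (({n} : Set ℕ) ×ˢ (univ : Set (ℕ → Z))) :=
    (measurableSet_singleton n).prod MeasurableSet.univ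
  rw [discountedLaw, Measure.sum_apply _ hms, tsum_eq_single n]
  · rw [Measure.smul_apply, Measure.map_apply measurable_prodMk_left hms]
    simp [Set.preimage]
  · intro t ht
    rw [Measure.smul_apply, Measure.map_apply measurable_prodMk_left hms]
    simp [Set.preimage, ht]

lemma discountedLaw_univ (h0 : 0 < β) (h1 : β < 1) :
    discountedLaw β κ z univ = ENNReal.ofReal (1 / (1 - β)) := by
  rw [← lintegral_one, lintegral_discountedLaw β κ z measurable_const, one_div,
    ← tsum_geometric_of_lt_one h0.le h1,
    ENNReal.ofReal_tsum_of_nonneg (fun n => by positivity) (summable_geometric_of_lt_one h0.le h1)]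
  simp

lemma isFiniteMeasure_discountedLaw (h0 : 0 < β) (h1 : β < 1) :
    IsFiniteMeasure (discountedLaw β κ z) :=
  ⟨by rw [discountedLaw_univ β κ z h0 h1]; exact ENNReal.ofReal_lt_top⟩

lemma measurePreserving_map_pinStart :
    MeasurePreserving (Prod.map id (pinStart z)) (discountedLaw β κ z) (discountedLaw β κ z) := by
  have hm : Measurable (Prod.map (id : ℕ → ℕ) (pinStart z)) :=
    measurable_id.prodMap (measurable_pinStart z)
  refine ⟨hm, ?_⟩
  rw [discountedLaw, Measure.map_sum hm.aemeasurable]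
  congr 1 with t : 1
  rw [Measure.map_smul, Measure.map_map hm measurable_prodMk_left]
  have : Prod.map id (pinStart z) ∘ Prod.mk t = Prod.mk t ∘ pinStart z := rfl
  rw [this, ← Measure.map_map measurable_prodMk_left (measurable_pinStart z),
    (measurePreserving_pinStart κ z).map_eq]

end DiscountedLaw

/-! ### Feasible plans -/

section Plan

variable {R : ℝ} {y : Z → ℝ} {a : ℝ} {C : ℕ → (ℕ → Z) → ℝ}

lemma measurable_piLE_wealth (hym : Measurable y)
    (hC : ∀ t, Measurable[Filtration.piLE (X := fun _ => Z) t] (C t)) (t : ℕ) :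
    Measurable[Filtration.piLE (X := fun _ => Z) t] (wealth R y a C t) := by
  induction t with
  | zero => exact @measurable_const _ _ _ (Filtration.piLE (X := fun _ => Z) 0) a
  | succ t ih =>
    have hle := (Filtration.piLE (X := fun _ : ℕ => Z)).mono t.le_succ
    have h1 : Measurable[Filtration.piLE (X := fun _ => Z) (t + 1)] (wealth R y a C t) :=
      ih.mono hle le_rfl
    have h2 : Measurable[Filtration.piLE (X := fun _ => Z) (t + 1)] (C t) :=
      (hC t).mono hle le_rfl
    have h3 := hym.comp (measurable_piLE_apply (Z := Z) (le_refl (t + 1)))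
    exact ((h1.sub h2).const_mul R).add h3

lemma IsFeasiblePlan.measurable (hC : IsFeasiblePlan R y a C) (t : ℕ) : Measurable (C t) :=
  (hC.adapted t).mono ((Filtration.piLE (X := fun _ : ℕ => Z)).le t) le_rfl

lemma IsFeasiblePlan.measurable_prod (hC : IsFeasiblePlan R y a C) :
    Measurable (fun p : ℕ × (ℕ → Z) => C p.1 p.2) :=
  measurable_from_prod_countable_right hC.measurable

lemma measurable_piLE_policyWealth (hym : Measurable y) {c : ℝ → Z → ℝ}
    (hc : Measurable (Function.uncurry c)) (t : ℕ) :
    Measurable[Filtration.piLE (X := fun _ => Z) t] (policyWealth R y c a t) ∧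
      Measurable[Filtration.piLE (X := fun _ => Z) t] (policyPlan R y c a t) := by
  have key : ∀ t, Measurable[Filtration.piLE (X := fun _ => Z) t] (policyWealth R y c a t) →
      Measurable[Filtration.piLE (X := fun _ => Z) t] (policyPlan R y c a t) := fun t h =>
    hc.comp (h.prodMk (measurable_piLE_apply (Z := Z) (le_refl t)))
  induction t with
  | zero =>
    have h : Measurable[Filtration.piLE (X := fun _ => Z) 0] (policyWealth R y c a 0) :=
      @measurable_const _ _ _ (Filtration.piLE (X := fun _ : ℕ => Z) 0) a
    exact ⟨h, key 0 h⟩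
  | succ t ih =>
    have hle := (Filtration.piLE (X := fun _ : ℕ => Z)).mono t.le_succ
    have h : Measurable[Filtration.piLE (X := fun _ => Z) (t + 1)] (policyWealth R y c a (t + 1)) :=
      (((ih.1.mono hle le_rfl).sub (ih.2.mono hle le_rfl)).const_mul R).add
        (hym.comp (measurable_piLE_apply (Z := Z) (le_refl (t + 1))))
    exact ⟨h, key _ h⟩

end Plan

/-- Expected lifetime utility of the optimal policy, as a real number. -/
def value (u : ℝ → EReal) (β R : ℝ) (κ : Kernel Z Z) [IsMarkovKernel κ] (y : Z → ℝ)
    (c : ℝ → Z → ℝ) (a : ℝ) (z : Z) : ℝ :=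
  ∫ p, realUtility u (policyPlan R y c a p.1 p.2) ∂discountedLaw β κ z

/-! ### Lifetime utility as a single integral. -/

section Lifetime

variable {u : ℝ → EReal} {β R : ℝ} {κ : Kernel Z Z} [IsMarkovKernel κ] {y : Z → ℝ}
  {a : ℝ} {z : Z} {C : ℕ → (ℕ → Z) → ℝ}

lemma lifetimeUtility_eq (hu : UtilityAssumption u) (hC : IsFeasiblePlan R y a C) :
    lifetimeUtility u β (pathLaw κ z) C =
      ((∫⁻ p, (u (C p.1 p.2)).toENNReal ∂discountedLaw β κ z : ℝ≥0∞) : EReal) -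
      ((∫⁻ p, (-u (C p.1 p.2)).toENNReal ∂discountedLaw β κ z : ℝ≥0∞) : EReal) := by
  obtain ⟨v, hv, hvu⟩ := hu.exists_measurable_eq
  have e : ∀ t ω, u (C t ω) = v (C t ω) := fun t ω => (hvu _ (hC.nonneg t ω)).symm
  have hm : Measurable (fun p : ℕ × (ℕ → Z) => v (C p.1 p.2)) := hv.comp hC.measurable_prod
  simp only [lifetimeUtility, e]
  rw [lintegral_discountedLaw β κ z hm.ereal_toENNReal,
    lintegral_discountedLaw β κ z (f := fun p => (-v (C p.1 p.2)).toENNReal)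
      hm.neg.ereal_toENNReal]

lemma coe_integral_eq_lintegral_sub {α : Type*} [MeasurableSpace α] {μ : Measure α} {g : α → ℝ}
    (hg : Integrable g μ) : ((∫ p, g p ∂μ : ℝ) : EReal) =
      ((∫⁻ p, ENNReal.ofReal (g p) ∂μ : ℝ≥0∞) : EReal) -
      ((∫⁻ p, ENNReal.ofReal (-g p) ∂μ : ℝ≥0∞) : EReal) := by
  have hpos : ∫⁻ p, ENNReal.ofReal (g p) ∂μ ≠ ⊤ := hg.lintegral_lt_top.ne
  have hneg : ∫⁻ p, ENNReal.ofReal (-g p) ∂μ ≠ ⊤ := hg.neg.lintegral_lt_top.ne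
  rw [integral_eq_lintegral_pos_part_sub_lintegral_neg_part hg, EReal.coe_sub,
    EReal.coe_ennreal_toReal hpos, EReal.coe_ennreal_toReal hneg]

/-- An integrable minorant is enough to bound a competing plan from below; its own utility need not
be shown integrable. -/
lemma integral_le_lifetimeUtility (hu : UtilityAssumption u) (hC : IsFeasiblePlan R y a C)
    {g : ℕ × (ℕ → Z) → ℝ} (hg : Integrable g (discountedLaw β κ z))
    (hle : ∀ᵐ p ∂discountedLaw β κ z, (g p : EReal) ≤ u (C p.1 p.2)) :
    ((∫ p, g p ∂discountedLaw β κ z : ℝ) : EReal) ≤ lifetimeUtility u β (pathLaw κ z) C := by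
  rw [lifetimeUtility_eq hu hC, coe_integral_eq_lintegral_sub hg]
  refine EReal.sub_le_sub ?_ ?_
  · refine EReal.coe_ennreal_le_coe_ennreal_iff.2 (lintegral_mono_ae ?_)
    filter_upwards [hle] with p hp
    simpa using EReal.toENNReal_le_toENNReal hp
  · refine EReal.coe_ennreal_le_coe_ennreal_iff.2 (lintegral_mono_ae ?_)
    filter_upwards [hle] with p hp
    simpa [← EReal.coe_neg] using EReal.toENNReal_le_toENNReal (EReal.neg_le_neg_iff.2 hp)

lemma lintegral_wealth_le (hR : 1 ≤ R) (hym : Measurable y) (hy0 : ∀ z, 0 ≤ y z)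
    {B : ℝ} (hB0 : 0 ≤ B)
    (hB : ∀ z, ∫⁻ z', ENNReal.ofReal (y z') ∂(κ z) ≤ ENNReal.ofReal B) (ha : 0 ≤ a)
    (hC : IsFeasiblePlan R y a C) (t : ℕ) :
    ∫⁻ ω, ENNReal.ofReal (wealth R y a C t ω) ∂pathLaw κ z ≤
      ENNReal.ofReal (R ^ t * (a + t * B)) := by
  have hR0 : 0 < R := by linarith
  induction t with
  | zero => simp [wealth]
  | succ t ih =>
    have hw : Measurable (wealth R y a C t) :=
      (measurable_piLE_wealth hym hC.adapted t).mono
        ((Filtration.piLE (X := fun _ : ℕ => Z)).le t) le_rfl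
    calc ∫⁻ ω, ENNReal.ofReal (wealth R y a C (t + 1) ω) ∂pathLaw κ z
        ≤ ∫⁻ ω, (ENNReal.ofReal R * ENNReal.ofReal (wealth R y a C t ω) +
            ENNReal.ofReal (y (ω (t + 1)))) ∂pathLaw κ z := by
          refine lintegral_mono fun ω => ?_
          have h1 := hC.nonneg t ω
          have h2 := hC.le_wealth t ω
          rw [← ENNReal.ofReal_mul hR0.le,
            ← ENNReal.ofReal_add (mul_nonneg hR0.le (h1.trans h2)) (hy0 _)]
          apply ENNReal.ofReal_le_ofReal
          simp only [wealth]
          nlinarith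
      _ = ENNReal.ofReal R * ∫⁻ ω, ENNReal.ofReal (wealth R y a C t ω) ∂pathLaw κ z +
            ∫⁻ ω, ∫⁻ z', ENNReal.ofReal (y z') ∂κ (ω t) ∂pathLaw κ z := by
          rw [lintegral_add_left (by fun_prop), lintegral_const_mul _ (by fun_prop),
            lintegral_pathLaw_succ κ z t (f := fun z' => ENNReal.ofReal (y z')) (by fun_prop)]
      _ ≤ ENNReal.ofReal R * ENNReal.ofReal (R ^ t * (a + t * B)) + ENNReal.ofReal B := by
          gcongr
          calc _ ≤ ∫⁻ _, ENNReal.ofReal B ∂pathLaw κ z := lintegral_mono fun ω => hB _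
            _ = _ := by simp
      _ ≤ _ := by
          rw [← ENNReal.ofReal_mul hR0.le, ← ENNReal.ofReal_add (by positivity) hB0]
          apply ENNReal.ofReal_le_ofReal
          have : 1 ≤ R ^ (t + 1) := one_le_pow₀ hR
          push_cast
          rw [pow_succ'] at *
          nlinarith

/-- Utility grows at most linearly and expected wealth at most like `t R ^ t`, so `β R < 1` makes
the discounted sum converge, uniformly in the state and the plan. -/
lemma exists_lintegral_toENNReal_le (hu : UtilityAssumption u) (hβ : 0 < β) (hR : 1 ≤ R)
    (hβR : β * R < 1) (hy : IncomeAssumption κ y) (ha : 0 ≤ a) :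
    ∃ M : ℝ≥0, ∀ z C, IsFeasiblePlan R y a C →
      ∫⁻ p, (u (C p.1 p.2)).toENNReal ∂discountedLaw β κ z ≤ M := by
  obtain ⟨B', hB'⟩ := hy.bounded_mean
  set B := max B' 0 with hBdef
  have hB0 : 0 ≤ B := le_max_right _ _
  have hB : ∀ z, ∫⁻ z', ENNReal.ofReal (y z') ∂(κ z) ≤ ENNReal.ofReal B := fun z =>
    (hB' z).trans (ENNReal.ofReal_le_ofReal (le_max_left _ _))
  have hR0 : 0 < R := by linarith
  set k := marginalUtility u 1
  have hk : 0 < k := hu.deriv_pos 1 one_pos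
  set m := |realUtility u 1|
  have hm : 0 ≤ m := abs_nonneg _
  set S : ℕ → ℝ := fun t => β ^ t * (m + k * (R ^ t * (a + t * B))) with hS
  have hβ1 : β < 1 := by nlinarith
  have hsum : Summable S := by
    have hq : 0 < β * R := by positivity
    have h1 := (summable_geometric_of_lt_one hβ.le hβ1).mul_left m
    have h2 := (summable_geometric_of_lt_one hq.le hβR).mul_left (k * a)
    have h3 := (summable_pow_mul_geometric_of_norm_lt_one (r := β * R) 1
      (by rw [Real.norm_of_nonneg hq.le]; exact hβR)).mul_left (k * B)
    refine ((h1.add h2).add h3).congr fun t => ?_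
    simp only [hS, mul_pow]
    ring
  have hS0 : ∀ t, 0 ≤ S t := fun t => by simp only [hS]; positivity
  refine ⟨(∑' t, S t).toNNReal, fun z C hC => ?_⟩
  calc ∫⁻ p, (u (C p.1 p.2)).toENNReal ∂discountedLaw β κ z
      ≤ ∫⁻ p, (ENNReal.ofReal m + ENNReal.ofReal k * ENNReal.ofReal (C p.1 p.2))
          ∂discountedLaw β κ z := lintegral_mono fun p => hu.toENNReal_le (hC.nonneg _ _)
    _ = ∑' t, ENNReal.ofReal (β ^ t) *
          ∫⁻ ω, (ENNReal.ofReal m + ENNReal.ofReal k * ENNReal.ofReal (C t ω)) ∂pathLaw κ z := by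
        have := hC.measurable_prod
        exact lintegral_discountedLaw β κ z (by fun_prop)
    _ ≤ ∑' t, ENNReal.ofReal (S t) := by
        refine ENNReal.tsum_le_tsum fun t => ?_
        have hCt := hC.measurable t
        rw [lintegral_add_left (by fun_prop), lintegral_const_mul _ (by fun_prop),
          ENNReal.ofReal_mul (by positivity)]
        gcongr
        rw [ENNReal.ofReal_add hm (by positivity), ENNReal.ofReal_mul hk.le]
        gcongr
        · simp
        · exact (lintegral_mono fun ω => ENNReal.ofReal_le_ofReal (hC.le_wealth t ω)).trans
            (lintegral_wealth_le hR hy.measurable hy.nonneg hB0 hB ha hC t)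
    _ = _ := by
        rw [← ENNReal.ofReal_tsum_of_nonneg hS0 hsum]
        rfl

lemma lifetimeUtility_eq_integral (hu : UtilityAssumption u) (hC : IsFeasiblePlan R y a C)
    (hfin : ∫⁻ p, (u (C p.1 p.2)).toENNReal ∂discountedLaw β κ z ≠ ⊤)
    (hbot : lifetimeUtility u β (pathLaw κ z) C ≠ ⊥) :
    Integrable (fun p => realUtility u (C p.1 p.2)) (discountedLaw β κ z) ∧
      (∀ᵐ p ∂discountedLaw β κ z, u (C p.1 p.2) ≠ ⊥) ∧
      lifetimeUtility u β (pathLaw κ z) C =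
        ((∫ p, realUtility u (C p.1 p.2) ∂discountedLaw β κ z : ℝ) : EReal) := by
  rw [lifetimeUtility_eq hu hC] at hbot
  have hneg : ∫⁻ p, (-u (C p.1 p.2)).toENNReal ∂discountedLaw β κ z ≠ ⊤ := by
    -- In `EReal`, subtracting `⊤` yields `⊥`, even from `⊤`.
    intro h
    rw [h] at hbot
    simp at hbot
  obtain ⟨v, hv, hvu⟩ := hu.exists_measurable_eq
  have e : ∀ p : ℕ × (ℕ → Z), u (C p.1 p.2) = v (C p.1 p.2) :=
    fun p => (hvu _ (hC.nonneg _ _)).symm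
  have hm : Measurable (fun p : ℕ × (ℕ → Z) => u (C p.1 p.2)) := by
    simp only [e]
    exact hv.comp hC.measurable_prod
  have hbotae : ∀ᵐ p ∂discountedLaw β κ z, u (C p.1 p.2) ≠ ⊥ := by
    filter_upwards [ae_lt_top hm.neg.ereal_toENNReal hneg] with p hp h
    simp [h] at hp
  have epos : ∫⁻ p, ENNReal.ofReal (realUtility u (C p.1 p.2)) ∂discountedLaw β κ z =
      ∫⁻ p, (u (C p.1 p.2)).toENNReal ∂discountedLaw β κ z := by
    refine lintegral_congr_ae ?_
    filter_upwards [hbotae] with p hp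
    rw [← hu.coe_realUtility (hC.nonneg _ _) hp]
    simp
  have eneg : ∫⁻ p, ENNReal.ofReal (-realUtility u (C p.1 p.2)) ∂discountedLaw β κ z =
      ∫⁻ p, (-u (C p.1 p.2)).toENNReal ∂discountedLaw β κ z := by
    refine lintegral_congr_ae ?_
    filter_upwards [hbotae] with p hp
    rw [← hu.coe_realUtility (hC.nonneg _ _) hp, ← EReal.coe_neg]
    simp
  have hmr : Measurable (fun p : ℕ × (ℕ → Z) => realUtility u (C p.1 p.2)) := hm.ereal_toReal
  have hint : Integrable (fun p => realUtility u (C p.1 p.2)) (discountedLaw β κ z) := by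
    refine ⟨hmr.aestronglyMeasurable, ?_⟩
    rw [hasFiniteIntegral_iff_norm]
    have : ∀ p : ℕ × (ℕ → Z), ENNReal.ofReal ‖realUtility u (C p.1 p.2)‖ ≤
        ENNReal.ofReal (realUtility u (C p.1 p.2)) +
          ENNReal.ofReal (-realUtility u (C p.1 p.2)) := fun p => by
      rcases le_total 0 (realUtility u (C p.1 p.2)) with h | h
      · rw [Real.norm_of_nonneg h]; exact le_self_add
      · rw [Real.norm_of_nonpos h]; exact le_add_self
    refine (lintegral_mono this).trans_lt ?_
    rw [lintegral_add_left hmr.ennreal_ofReal, epos, eneg]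
    exact ENNReal.add_lt_top.2 ⟨hfin.lt_top, hneg.lt_top⟩
  refine ⟨hint, hbotae, ?_⟩
  rw [lifetimeUtility_eq hu hC, coe_integral_eq_lintegral_sub hint, epos, eneg]

end Lifetime


/-- The standing assumptions of the income fluctuation problem, together with an optimal policy. -/
structure IsSolution (u : ℝ → EReal) (β R : ℝ) (κ : Kernel Z Z) [IsMarkovKernel κ]
    (y : Z → ℝ) (c : ℝ → Z → ℝ) : Prop where
  utility : UtilityAssumption u
  income : IncomeAssumption κ y
  discount_pos : 0 < β
  one_le_return : 1 ≤ R
  discount_mul_return : β * R < 1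
  policy : IsOptimalPolicy u β R κ y c

/-! ### Comparing the optimal policy with perturbed plans. -/

namespace IsSolution

variable {u : ℝ → EReal} {β R : ℝ} {κ : Kernel Z Z} [IsMarkovKernel κ] {y : Z → ℝ}
  {c : ℝ → Z → ℝ} (h : IsSolution u β R κ y c)
include h

lemma return_pos : 0 < R := one_pos.trans_le h.one_le_return

lemma discount_lt_one : β < 1 := by
  nlinarith [h.discount_pos, h.one_le_return, h.discount_mul_return]

lemma policyWealth_nonneg {a : ℝ} (ha : 0 ≤ a) (t : ℕ) (ω : ℕ → Z) :
    0 ≤ policyWealth R y c a t ω := by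
  induction t with
  | zero => exact ha
  | succ t ih =>
    have h1 := h.policy.le_wealth _ (ω t) ih
    have h2 := h.income.nonneg (ω (t + 1))
    have := mul_nonneg h.return_pos.le (sub_nonneg.2 h1)
    simp only [policyWealth]
    linarith

lemma isFeasiblePlan {a : ℝ} (ha : 0 ≤ a) : IsFeasiblePlan R y a (policyPlan R y c a) where
  adapted t := (measurable_piLE_policyWealth h.income.measurable h.policy.measurable t).2
  nonneg t ω := h.policy.nonneg _ _ (h.policyWealth_nonneg ha t ω)
  le_wealth t ω := by
    rw [wealth_eq_policyWealth]
    exact h.policy.le_wealth _ _ (h.policyWealth_nonneg ha t ω)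

lemma policyPlan_spec {a : ℝ} (ha : 0 < a) (z : Z) :
    Integrable (fun p => realUtility u (policyPlan R y c a p.1 p.2)) (discountedLaw β κ z) ∧
      (∀ᵐ p ∂discountedLaw β κ z, u (policyPlan R y c a p.1 p.2) ≠ ⊥) ∧
      lifetimeUtility u β (pathLaw κ z) (policyPlan R y c a) =
        (value u β R κ y c a z : EReal) := by
  obtain ⟨M, hM⟩ := exists_lintegral_toENNReal_le h.utility h.discount_pos h.one_le_return
    h.discount_mul_return h.income ha.le
  exact lifetimeUtility_eq_integral h.utility (h.isFeasiblePlan ha.le)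
    (ne_top_of_le_ne_top ENNReal.coe_ne_top (hM z _ (h.isFeasiblePlan ha.le)))
    (h.policy.value_ne_bot a z ha)

/-- Plans that are feasible on the paths starting at `z` yield at most the value. -/
lemma integral_le_value {a : ℝ} (ha : 0 < a) {z : Z} {D : ℕ → (ℕ → Z) → ℝ}
    (hD : ∀ t, Measurable[Filtration.piLE (X := fun _ => Z) t] (D t))
    (hfeas : ∀ t ω, ω 0 = z → 0 ≤ D t ω ∧ D t ω ≤ wealth R y a D t ω)
    {g : ℕ × (ℕ → Z) → ℝ} (hg : Integrable g (discountedLaw β κ z))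
    (hle : ∀ᵐ p ∂discountedLaw β κ z, p.2 0 = z → (g p : EReal) ≤ u (D p.1 p.2)) :
    ∫ p, g p ∂discountedLaw β κ z ≤ value u β R κ y c a z := by
  have hw : ∀ t ω, wealth R y a (fun t ω => D t (pinStart z ω)) t ω =
      wealth R y a D t (pinStart z ω) := by
    intro t ω
    induction t with
    | zero => rfl
    | succ t ih => simp [wealth, ih]
  -- Evaluating `D` on pinned paths makes it feasible everywhere without changing the integral.
  have hC : IsFeasiblePlan R y a (fun t ω => D t (pinStart z ω)) :=
    { adapted := fun t => (hD t).comp (measurable_piLE_pinStart z t)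
      nonneg := fun t ω => (hfeas t _ (pinStart_zero z ω)).1
      le_wealth := fun t ω => by
        rw [hw]
        exact (hfeas t _ (pinStart_zero z ω)).2 }
  have hσ := measurePreserving_map_pinStart β κ z
  have hint : Integrable (g ∘ Prod.map id (pinStart z)) (discountedLaw β κ z) :=
    hσ.integrable_comp_of_integrable hg
  have heq : ∫ p, g p ∂discountedLaw β κ z =
      ∫ p, (g ∘ Prod.map id (pinStart z)) p ∂discountedLaw β κ z := by
    have e := integral_map (μ := discountedLaw β κ z) hσ.measurable.aemeasurable (f := g)
      (by rw [hσ.map_eq]; exact hg.aestronglyMeasurable)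
    rwa [hσ.map_eq] at e
  have hopt := h.policy.optimal a z ha _ hC
  rw [(h.policyPlan_spec ha z).2.2] at hopt
  rw [heq, ← EReal.coe_le_coe_iff]
  refine (integral_le_lifetimeUtility h.utility hC hint ?_).trans hopt
  filter_upwards [hσ.quasiMeasurePreserving.ae hle] with p hp
  exact hp (pinStart_zero z p.2)

/-- The date-0 slice has mass `1`, and on pinned paths consumption there is the constant `c a z`;
utility `⊥` would contradict almost sure finiteness. -/
lemma utility_policy_ne_bot {a : ℝ} (ha : 0 < a) (z : Z) : u (c a z) ≠ ⊥ := by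
  intro hbot
  have hae := (measurePreserving_map_pinStart β κ z).quasiMeasurePreserving.ae
    (h.policyPlan_spec ha z).2.1
  have hsub : ({0} : Set ℕ) ×ˢ (univ : Set (ℕ → Z)) ⊆
      {p | ¬ u (policyPlan R y c a (Prod.map id (pinStart z) p).1
        (Prod.map id (pinStart z) p).2) ≠ ⊥} := by
    rintro ⟨t, ω⟩ ⟨rfl, -⟩
    simp [policyPlan, policyWealth, hbot]
  have := measure_mono_null hsub (ae_iff.1 hae)
  rw [discountedLaw_slice] at this
  simp at this

/-- Consuming `e₀` more at date `0` and `e₁` more at date `1` than prescribed by the optimal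
policy. -/
lemma value_perturb {a a' : ℝ} (ha : 0 < a) (ha' : 0 < a') {z : Z} {e₀ e₁ k₀ k₁ : ℝ}
    (he : R * (a' - a - e₀) = e₁) (h0 : 0 ≤ c a z + e₀) (h0' : c a z + e₀ ≤ a')
    (h1 : ∀ z', 0 ≤ c (R * (a - c a z) + y z') z' + e₁)
    (hk0 : ((realUtility u (c a z) + k₀ : ℝ) : EReal) ≤ u (c a z + e₀))
    (hk1 : ∀ z', u (c (R * (a - c a z) + y z') z') ≠ ⊥ →
      ((realUtility u (c (R * (a - c a z) + y z') z') + k₁ : ℝ) : EReal) ≤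
        u (c (R * (a - c a z) + y z') z' + e₁)) :
    value u β R κ y c a z + k₀ + β * k₁ ≤ value u β R κ y c a' z := by
  have := isFiniteMeasure_discountedLaw β κ z h.discount_pos h.discount_lt_one
  obtain ⟨hint, hbot, -⟩ := h.policyPlan_spec ha z
  set e : ℕ → ℝ := fun t => if t = 0 then e₀ else if t = 1 then e₁ else 0 with hedef
  set D : ℕ → (ℕ → Z) → ℝ := fun t ω => policyPlan R y c a t ω + e t with hD
  -- By `he`, wealth at date `1` changes by exactly `e₁`. This is consumed at once, so wealth from
  -- date `2` on is unchanged.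
  have hw : ∀ t ω, wealth R y a' D (t + 1) ω =
      policyWealth R y c a (t + 1) ω + if t = 0 then e₁ else 0 := by
    intro t ω
    induction t with
    | zero =>
      simp only [wealth, policyWealth, hD, policyPlan, hedef, if_true]
      linarith
    | succ t ih =>
      have hs : policyWealth R y c a (t + 1 + 1) ω = R * (policyWealth R y c a (t + 1) ω -
        policyPlan R y c a (t + 1) ω) + y (ω (t + 1 + 1)) := rfl
      rw [wealth, ih, hs]
      simp only [hD, hedef]
      rcases t with _ | t <;> simp
  have hplan1 : ∀ ω : ℕ → Z, ω 0 = z → policyPlan R y c a 1 ω =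
      c (R * (a - c a z) + y (ω 1)) (ω 1) := by
    rintro ω rfl
    rfl
  set s : ℕ → Set (ℕ × (ℕ → Z)) := fun n => {n} ×ˢ univ with hs
  have hsm : ∀ n, MeasurableSet (s n) := fun n =>
    (measurableSet_singleton n).prod MeasurableSet.univ
  have hI : ∀ n k, Integrable ((s n).indicator fun _ => (k : ℝ)) (discountedLaw β κ z) :=
    fun n k => (integrable_const k).indicator (hsm n)
  have hIv : ∀ n k, ∫ p, (s n).indicator (fun _ => (k : ℝ)) p ∂discountedLaw β κ z = β ^ n * k := by
    intro n k
    rw [integral_indicator_const _ (hsm n), Measure.real, discountedLaw_slice,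
      ENNReal.toReal_ofReal (pow_nonneg h.discount_pos.le n), smul_eq_mul]
  have key := h.integral_le_value (z := z) ha' (D := D)
    (g := fun p => realUtility u (policyPlan R y c a p.1 p.2) +
      (s 0).indicator (fun _ => k₀) p + (s 1).indicator (fun _ => k₁) p)
    (fun t => ((h.isFeasiblePlan ha.le).adapted t).add_const (e t)) ?_
    ((hint.add (hI 0 k₀)).add (hI 1 k₁)) ?_
  · have e1 := integral_add (hint.add (hI 0 k₀)) (hI 1 k₁)
    have e2 := integral_add hint (hI 0 k₀)
    simp only [Pi.add_apply] at e1 e2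
    rw [e1, e2, hIv, hIv] at key
    simpa [value] using key
  · rintro (_ | _ | t) ω rfl
    · simpa [hD, hedef, policyPlan, policyWealth, wealth] using ⟨h0, h0'⟩
    · rw [hw]
      simp only [hD, zero_add, hplan1 ω rfl]
      have := h1 (ω 1)
      simp only [hedef, one_ne_zero, if_false, if_true]
      refine ⟨this, ?_⟩
      have := (h.isFeasiblePlan ha.le).le_wealth 1 ω
      rw [wealth_eq_policyWealth, hplan1 ω rfl] at this
      linarith
    · rw [hw]
      simp only [hD, hedef]
      have h1 := (h.isFeasiblePlan ha.le).le_wealth (t + 1 + 1) ω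
      rw [wealth_eq_policyWealth] at h1
      simpa using ⟨(h.isFeasiblePlan ha.le).nonneg (t + 1 + 1) ω, h1⟩
  · filter_upwards [hbot] with p hp hz
    obtain ⟨t, ω⟩ := p
    rcases t with _ | _ | t
    · simpa [hs, hD, hedef, policyPlan, policyWealth, show ω 0 = z from hz] using hk0
    · have := hk1 (ω 1)
      rw [← hplan1 ω hz] at this
      simpa [hs, hD, hedef] using this hp
    · have := (h.utility.coe_realUtility ((h.isFeasiblePlan ha.le).nonneg (t + 1 + 1) ω) hp).le
      simpa [hs, hD, hedef] using this

/-- Let consumption today absorb the whole change `e` in wealth, of either sign; the future is then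
unaffected. -/
lemma value_add_le {a e : ℝ} (ha : 0 < a) (hae : 0 < a + e) {z : Z} (hce : 0 < c a z + e) :
    value u β R κ y c a z + (realUtility u (c a z + e) - realUtility u (c a z)) ≤
      value u β R κ y c (a + e) z := by
  have hw : ∀ z', 0 ≤ R * (a - c a z) + y z' := fun z' =>
    add_nonneg (mul_nonneg h.return_pos.le (sub_nonneg.2 (h.policy.le_wealth a z ha.le)))
      (h.income.nonneg z')
  have := h.value_perturb (z := z) ha hae (e₀ := e) (e₁ := 0) (k₁ := 0)
    (k₀ := realUtility u (c a z + e) - realUtility u (c a z)) (by ring) hce.le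
    (by linarith [h.policy.le_wealth a z ha.le])
    (fun z' => by simpa using h.policy.nonneg _ z' (hw z'))
    (by rw [add_sub_cancel, h.utility.coe_realUtility_of_pos hce])
    (fun z' hz' => by simp [h.utility.coe_realUtility (h.policy.nonneg _ z' (hw z')) hz'])
  simpa using this

/-- The Euler inequality: an agent who saves cannot always have consumption tomorrow so high that
shifting consumption from tomorrow to today would be an improvement. -/
lemma exists_lt_of_marginalUtility_lt {a x : ℝ} {z : Z} (hpos : 0 < c a z) (hlt : c a z < a)
    (hx : 0 < x) (hmu : β * R * marginalUtility u x < marginalUtility u (c a z)) :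
    ∃ z', c (R * (a - c a z) + y z') z' < x := by
  by_contra! hcon
  have ha : 0 < a := hpos.trans hlt
  have hR := h.return_pos
  have t1 : Tendsto (fun δ : ℝ => c a z + δ) (𝓝[>] 0) (𝓝 (c a z)) :=
    (Continuous.tendsto' (by fun_prop) 0 _ (by simp)).mono_left nhdsWithin_le_nhds
  have t2 : Tendsto (fun δ : ℝ => x - R * δ) (𝓝[>] 0) (𝓝 x) :=
    (Continuous.tendsto' (by fun_prop) 0 _ (by simp)).mono_left nhdsWithin_le_nhds
  have t3 := ((h.utility.continuousAt_marginalUtility hx).tendsto.comp t2).const_mul (β * R)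
  have t4 := (h.utility.continuousAt_marginalUtility hpos).tendsto.comp t1
  -- Consume `δ` more today and `R δ` less tomorrow. For small `δ` this is feasible, and the strict
  -- inequality of marginal utilities survives at the shifted points.
  obtain ⟨δ, hδ, hδ1, hδ2, hδ3⟩ := (eventually_mem_nhdsWithin.and ((t1.eventually_lt_const hlt).and
    ((t2.eventually_const_lt hx).and (t3.eventually_lt t4 hmu)))).exists
  have hδ : 0 < δ := hδ
  simp only [Function.comp_apply] at hδ3
  have := h.value_perturb (z := z) ha ha (e₀ := δ) (e₁ := -(R * δ))
    (k₀ := marginalUtility u (c a z + δ) * δ) (k₁ := -(marginalUtility u (x - R * δ) * (R * δ)))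
    (by ring) (by linarith) hδ1.le (fun z' => by linarith [hcon z']) ?_ ?_
  · have : 0 < δ * (marginalUtility u (c a z + δ) - β * R * marginalUtility u (x - R * δ)) :=
      mul_pos hδ (by linarith)
    linarith
  · rw [← h.utility.coe_realUtility_of_pos (by linarith : 0 < c a z + δ), EReal.coe_le_coe_iff]
    linarith [h.utility.le_tangent_of_pos (by linarith : 0 < c a z + δ) hpos]
  · intro z' _
    set x' := c (R * (a - c a z) + y z') z'
    have hx' : x ≤ x' := hcon z'
    have hp : 0 < x' + -(R * δ) := by linarith
    rw [← h.utility.coe_realUtility_of_pos hp, EReal.coe_le_coe_iff]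
    have e1 := h.utility.le_tangent_of_pos hp (hx.trans_le hx')
    have e2 := h.utility.strictAntiOn_marginalUtility.antitoneOn (mem_Ioi.2 hδ2) (mem_Ioi.2 hp)
      (by linarith)
    have : 0 < R * δ := by positivity
    nlinarith

/-- Wealth is affine in initial wealth and plan jointly, so the mixture of two optimal plans is
feasible from the mixed wealth; concavity of `u` does the rest. -/
lemma concaveOn_value (z : Z) : ConcaveOn ℝ (Ioi 0) (fun a => value u β R κ y c a z) := by
  refine concaveOn_iff_forall_pos.2 ⟨convex_Ioi 0, fun a ha b hb p q hp hq hpq => ?_⟩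
  have ha : 0 < a := ha
  have hb : 0 < b := hb
  obtain ⟨inta, bota, -⟩ := h.policyPlan_spec ha z
  obtain ⟨intb, botb, -⟩ := h.policyPlan_spec hb z
  have fa := h.isFeasiblePlan ha.le
  have fb := h.isFeasiblePlan hb.le
  have hw : ∀ t ω, wealth R y (p * a + q * b)
      (fun t ω => p * policyPlan R y c a t ω + q * policyPlan R y c b t ω) t ω =
      p * wealth R y a (policyPlan R y c a) t ω + q * wealth R y b (policyPlan R y c b) t ω := by
    intro t ω
    induction t with
    | zero => rfl
    | succ t ih =>
      obtain rfl : q = 1 - p := by linarith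
      simp only [wealth, ih]
      ring
  have := h.integral_le_value (z := z) (a := p * a + q * b) (by positivity)
    (D := fun t ω => p * policyPlan R y c a t ω + q * policyPlan R y c b t ω)
    (g := fun x => p * realUtility u (policyPlan R y c a x.1 x.2) +
      q * realUtility u (policyPlan R y c b x.1 x.2))
    (fun t => ((fa.adapted t).const_mul p).add ((fb.adapted t).const_mul q))
    (fun t ω _ => by
      have a1 := fa.nonneg t ω
      have b1 := fb.nonneg t ω
      have a2 := fa.le_wealth t ω
      have b2 := fb.le_wealth t ω
      rw [hw]
      exact ⟨by positivity, by gcongr⟩)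
    ((inta.const_mul p).add (intb.const_mul q)) ?_
  · rw [integral_add (inta.const_mul p) (intb.const_mul q), integral_const_mul,
      integral_const_mul] at this
    exact this
  · filter_upwards [bota, botb] with x hxa hxb _
    exact h.utility.concave_le (fa.nonneg _ _) (fb.nonneg _ _) hxa hxb hp hq hpq

lemma exists_value_le {a : ℝ} (ha : 0 < a) : ∃ M, ∀ z, value u β R κ y c a z ≤ M := by
  obtain ⟨M, hM⟩ := exists_lintegral_toENNReal_le h.utility h.discount_pos h.one_le_return
    h.discount_mul_return h.income ha.le
  refine ⟨M, fun z => ?_⟩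
  have hf := h.isFeasiblePlan ha.le
  rw [value, integral_eq_lintegral_pos_part_sub_lintegral_neg_part (h.policyPlan_spec ha z).1]
  have h1 : ∫⁻ p, ENNReal.ofReal (realUtility u (policyPlan R y c a p.1 p.2))
      ∂discountedLaw β κ z ≤ M := by
    refine (lintegral_mono fun p => ?_).trans (hM z _ hf)
    by_cases hb : u (policyPlan R y c a p.1 p.2) = ⊥
    · simp [hb, realUtility]
    · rw [← h.utility.coe_realUtility (hf.nonneg _ _) hb]
      simp [realUtility]
  have h2 := ENNReal.toReal_mono ENNReal.coe_ne_top h1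
  rw [ENNReal.coe_toReal] at h2
  linarith [ENNReal.toReal_nonneg (a := ∫⁻ p, ENNReal.ofReal
    (-realUtility u (policyPlan R y c a p.1 p.2)) ∂discountedLaw β κ z)]

/-- With a positive interest rate, consuming the interest on initial wealth is feasible. -/
lemma le_value_of_one_lt (hR1 : 1 < R) {a : ℝ} (ha : 0 < a) (z : Z) :
    1 / (1 - β) * realUtility u ((1 - 1 / R) * a) ≤ value u β R κ y c a z := by
  have := isFiniteMeasure_discountedLaw β κ z h.discount_pos h.discount_lt_one
  have hr : 0 < 1 - 1 / R := by
    rw [sub_pos, div_lt_one h.return_pos]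
    exact hR1
  have hx : 0 < (1 - 1 / R) * a := by positivity
  have hw : ∀ t (ω : ℕ → Z), a ≤ wealth R y a (fun _ _ => (1 - 1 / R) * a) t ω := by
    intro t ω
    induction t with
    | zero => exact le_rfl
    | succ t ih =>
      have e : R * (a - (1 - 1 / R) * a) = a := by
        have := h.return_pos.ne'
        field_simp
        ring
      have := mul_le_mul_of_nonneg_left (sub_le_sub_right ih ((1 - 1 / R) * a)) h.return_pos.le
      have := h.income.nonneg (ω (t + 1))
      simp only [wealth]
      linarith
  have key := h.integral_le_value (z := z) ha (D := fun _ _ => (1 - 1 / R) * a)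
    (g := fun _ => realUtility u ((1 - 1 / R) * a))
    (fun t => @measurable_const _ _ _ (Filtration.piLE (X := fun _ : ℕ => Z) t) _)
    (fun t ω _ => ⟨hx.le, le_trans (by
      have : 0 < 1 / R := one_div_pos.2 h.return_pos
      nlinarith) (hw t ω)⟩)
    (integrable_const _) (ae_of_all _ fun p _ => (h.utility.coe_realUtility_of_pos hx).le)
  rwa [integral_const, Measure.real, discountedLaw_univ β κ z h.discount_pos h.discount_lt_one,
    ENNReal.toReal_ofReal (one_div_nonneg.2 (sub_nonneg.2 h.discount_lt_one.le)),
    smul_eq_mul] at key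

/-- Half of the envelope condition: low consumption forces a steep value, since extra wealth could
be eaten at once. It also covers `c a z = 0`. -/
lemma mul_marginalUtility_le {a x : ℝ} (ha : 0 < a) {z : Z} (hx : c a z < x) :
    (x - c a z) * marginalUtility u x ≤
      value u β R κ y c (a + (x - c a z)) z - value u β R κ y c a z := by
  have h0 := h.policy.nonneg a z ha.le
  have h1 := h.value_add_le (z := z) (e := x - c a z) ha (by linarith) (by linarith)
  have h2 := h.utility.le_tangent (h0.trans_lt hx) h0 (h.utility_policy_ne_bot ha z)
  rw [add_sub_cancel] at h1
  linarith

/-- Consumption is nondecreasing in wealth. -/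
lemma le_of_le {a b : ℝ} {z : Z} (ha : 0 < a) (hab : a < b) : c a z ≤ c b z := by
  by_contra! hlt
  have hb0 := h.policy.nonneg b z (ha.trans hab).le
  have hca : 0 < c a z := hb0.trans_lt hlt
  have hle := h.policy.le_wealth a z ha.le
  -- A third of the gap keeps `c b z + e < c a z - e`. The value then has slope at least `u'(c b z +
  -- e)` right of `b` and at most `u'(c a z - e)` left of `a`, against concavity.
  set e := (c a z - c b z) / 3 with he
  have he0 : 0 < e := by rw [he]; linarith
  have h1 := h.mul_marginalUtility_le (z := z) (x := c b z + e) (ha.trans hab) (by linarith)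
  have hp : 0 < c a z - e := by linarith
  have h2 := h.value_add_le (z := z) (e := -e) ha (by linarith) (by linarith)
  have h3 := h.utility.le_tangent_of_pos hp hca
  have hconc := h.concaveOn_value z
  have s1 := hconc.slope_anti_adjacent (x := a - e) (y := a) (z := b)
    (mem_Ioi.2 (by linarith)) (mem_Ioi.2 (by linarith)) (by linarith) hab
  have s2 := hconc.slope_anti_adjacent (x := a) (y := b) (z := b + e)
    (mem_Ioi.2 ha) (mem_Ioi.2 (by linarith)) hab (by linarith)
  have s3 := s2.trans s1
  have e1 : b + e - b = e := by ring
  have e2 : a - (a - e) = e := by ring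
  rw [e1, e2, div_le_div_iff_of_pos_right he0] at s3
  have h4 := h.utility.strictAntiOn_marginalUtility (a := c b z + e) (b := c a z - e)
    (mem_Ioi.2 (by linarith)) (mem_Ioi.2 hp) (by linarith)
  rw [add_sub_cancel_left] at h1
  simp only [← sub_eq_add_neg] at h2
  nlinarith

/-- The value at wealth `2` is bounded above and that at `1` below, uniformly in the state, so by
concavity the slope beyond `2` is bounded. Consumption near `0` at wealth `2` would make that slope
arbitrarily large, as `u'(0) = ∞`. -/
lemma exists_uniform_lower_bound_of_one_lt (hR1 : 1 < R) :
    ∃ a : ℝ, 0 < a ∧ ∃ ε : ℝ, 0 < ε ∧ ∀ z, ε ≤ c a z := by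
  obtain ⟨M, hM⟩ := h.exists_value_le (a := 2) two_pos
  set L := 1 / (1 - β) * realUtility u ((1 - 1 / R) * 1)
  have hL : ∀ z, L ≤ value u β R κ y c 1 z := h.le_value_of_one_lt hR1 one_pos
  obtain ⟨x, hxM, hx0⟩ := ((h.utility.deriv_zero.eventually_gt_atTop (M - L)).and
    eventually_mem_nhdsWithin).exists
  refine ⟨2, two_pos, x, hx0, fun z => ?_⟩
  by_contra! hlt
  have h1 := h.mul_marginalUtility_le (z := z) two_pos hlt
  set e := x - c 2 z
  have he : 0 < e := sub_pos.2 hlt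
  have s := (h.concaveOn_value z).slope_anti_adjacent (x := 1) (y := 2) (z := 2 + e)
    (mem_Ioi.2 one_pos) (mem_Ioi.2 (by linarith)) (by norm_num) (by linarith)
  rw [add_sub_cancel_left, div_le_iff₀ he] at s
  have := hM z
  have := hL z
  nlinarith


/-- If consumption is uniformly bounded below at some wealth level, then it tends to infinity with
wealth, uniformly in the state. -/
lemma exists_forall_le {a₀ ε : ℝ} (ha₀ : 0 < a₀) (hε : 0 < ε) (hlow : ∀ z, ε ≤ c a₀ z) (X : ℝ) :
    ∃ A, a₀ ≤ A ∧ ∀ a, A ≤ a → ∀ z, X ≤ c a z := by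
  have hlow' : ∀ a, a₀ ≤ a → ∀ z, ε ≤ c a z := fun a ha z => by
    rcases ha.eq_or_lt with rfl | hlt
    · exact hlow z
    · exact (hlow z).trans (h.le_of_le ha₀ hlt)
  set S : Set ℝ := {x | ∃ A, a₀ ≤ A ∧ ∀ a, A ≤ a → ∀ z, x ≤ c a z} with hS
  have hεS : ε ∈ S := ⟨a₀, le_rfl, hlow'⟩
  have hdown : ∀ {x x'}, x ≤ x' → x' ∈ S → x ∈ S := fun hx ⟨A, hA, hA'⟩ =>
    ⟨A, hA, fun a ha z => hx.trans (hA' a ha z)⟩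
  by_contra hX
  have hbdd : BddAbove S := ⟨X, fun x hx => by
    by_contra! hlt
    exact hX (hdown hlt.le hx)⟩
  -- If `s` is finite, choose `x₁ ≤ s < x₂` near `s` with `x₁ ∈ S` and `β R u'(x₁) < u'(x₂)`.
  -- Consumption below `x₂` at high wealth would, by the Euler inequality, lead to consumption below
  -- `x₁` at wealth still above `A`. So `x₂ ∈ S`, a contradiction.
  set s := sSup S with hs
  have hs0 : 0 < s := hε.trans_le (le_csSup hbdd hεS)
  have hμ := h.utility.deriv_pos s hs0
  obtain ⟨v, hv1, hv2⟩ := exists_between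
    (show β * R * marginalUtility u s < marginalUtility u s by
      nlinarith [h.discount_mul_return])
  have hcont := (h.utility.continuousAt_marginalUtility hs0).tendsto
  have n1 : ∀ᶠ x in 𝓝 s, 0 < x ∧ β * R * marginalUtility u x < v :=
    (lt_mem_nhds hs0).and ((hcont.const_mul (β * R)).eventually_lt_const hv1)
  obtain ⟨l, hl, hl'⟩ := exists_Ioc_subset_of_mem_nhds n1 ⟨s - 1, by linarith⟩
  obtain ⟨x₁, hx₁S, hx₁⟩ := exists_lt_of_lt_csSup ⟨ε, hεS⟩ hl
  obtain ⟨hx₁0, hx₁v⟩ := hl' ⟨hx₁, le_csSup hbdd hx₁S⟩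
  obtain ⟨x₂, hvx₂, hsx₂⟩ := (((hcont.eventually_const_lt hv2).filter_mono
    nhdsWithin_le_nhds).and (eventually_mem_nhdsWithin (s := Ioi s))).exists
  have hsx₂ : s < x₂ := hsx₂
  refine absurd (le_csSup hbdd (show x₂ ∈ S from ?_)) (not_le.2 hsx₂)
  obtain ⟨A, hA, hA'⟩ := hx₁S
  refine ⟨A + x₂, by linarith, fun a ha z => ?_⟩
  by_contra! hlt
  have hcε := hlow' a (by linarith) z
  have hanti := h.utility.strictAntiOn_marginalUtility (mem_Ioi.2 (hε.trans_le hcε))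
    (mem_Ioi.2 (hs0.trans hsx₂)) hlt
  obtain ⟨z', hz'⟩ := h.exists_lt_of_marginalUtility_lt (hε.trans_le hcε) (by linarith) hx₁0
    (by linarith)
  have hy := h.income.nonneg z'
  have hR := h.one_le_return
  exact absurd (hA' (R * (a - c a z) + y z') (by nlinarith) z') (not_le.2 hz')

/-- Starting from low consumption `c b z ≤ M`, the Euler inequality produces states with
consumption at most `lam ^ n * M` at undiminished wealth, which is impossible. -/
lemma lt_of_le_sub {a₀ ε : ℝ} (ha₀ : 0 < a₀) (hε : 0 < ε) (hlow : ∀ z, ε ≤ c a₀ z)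
    {γ lam x₀ : ℝ} (hlam0 : 0 < lam) (hlam1 : lam < 1) (hγ : β * R < lam ^ γ) (hx₀ : 0 < x₀)
    (hRRA : ∀ x, x₀ ≤ x → relativeRiskAversion u x ≤ γ) :
    ∃ A, 0 < A ∧ ∀ b M z, 0 < M → A ≤ b - M / (1 - lam / R) → M < c b z := by
  -- The level `x₀ / lam` keeps `lam * N ≥ x₀` at each step below, where the bound on risk aversion
  -- applies.
  obtain ⟨A, hA, hA'⟩ := h.exists_forall_le ha₀ hε hlow (x₀ / lam)
  refine ⟨A, ha₀.trans_le hA, fun b M z hM0 hb => ?_⟩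
  by_contra! hM
  have hR := h.one_le_return
  have hR0 := h.return_pos
  have hlR : 0 < 1 - lam / R := by
    rw [sub_pos, div_lt_one hR0]
    linarith
  have hq : ∀ M, 0 < M → M ≤ M / (1 - lam / R) := fun M hM =>
    le_div_self hM.le hlR (by have : 0 < lam / R := by positivity
                              linarith)
  have hX : 0 < x₀ / lam := by positivity
  have hiter : ∀ n : ℕ, ∃ b z, c b z ≤ lam ^ n * M ∧ A ≤ b - lam ^ n * M / (1 - lam / R) ∧
      0 < lam ^ n * M := by
    intro n
    induction n with
    | zero => exact ⟨b, z, by simpa using hM, by simpa using hb, by simpa using hM0⟩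
    | succ n ih =>
      obtain ⟨b, z, h1, h2, h3⟩ := ih
      set N := lam ^ n * M with hN
      have hNq := hq N h3
      have hcX := hA' b (by linarith) z
      have hc0 : 0 < c b z := hX.trans_le hcX
      have hNx : x₀ ≤ lam * N := by
        rw [div_le_iff₀ hlam0] at hcX
        nlinarith
      have hmu := h.utility.rpow_mul_marginalUtility_le hx₀ hRRA hNx
        (show lam * N ≤ N by nlinarith)
      rw [Real.mul_rpow hlam0.le h3.le] at hmu
      have hNγ : 0 < N ^ γ := Real.rpow_pos_of_pos h3 γ
      have hmu' : lam ^ γ * marginalUtility u (lam * N) ≤ marginalUtility u N := by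
        refine le_of_mul_le_mul_left ?_ hNγ
        linarith
      have hanti := h.utility.strictAntiOn_marginalUtility.antitoneOn (mem_Ioi.2 hc0)
        (mem_Ioi.2 h3) h1
      have hlN : 0 < lam * N := by positivity
      have hpos := h.utility.deriv_pos _ hlN
      obtain ⟨z', hz'⟩ := h.exists_lt_of_marginalUtility_lt hc0 (by linarith) hlN (by nlinarith)
      refine ⟨_, z', by rw [pow_succ', mul_assoc]; exact hz'.le, ?_, by positivity⟩
      rw [pow_succ', mul_assoc, ← hN]
      -- Present values roll over: paying `N` and compounding leaves the present value of the
      -- remaining stream. The excess over it is thus multiplied by at least `R ≥ 1`.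
      have e : lam * N / (1 - lam / R) = R * (N / (1 - lam / R) - N) := by
        have : R - lam ≠ 0 := by linarith
        have : 1 - lam / R ≠ 0 := hlR.ne'
        field_simp
        ring
      rw [e]
      have hy := h.income.nonneg z'
      have : R * (b - N / (1 - lam / R)) ≤ R * (b - c b z) - R * (N / (1 - lam / R) - N) := by
        nlinarith
      have : A ≤ R * (b - N / (1 - lam / R)) := by nlinarith
      linarith
  obtain ⟨n, hn⟩ := ((tendsto_pow_atTop_nhds_zero_of_lt_one hlam0.le hlam1).mul_const
    M).eventually_lt_const (show 0 * M < x₀ / lam by simpa using hX) |>.exists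
  obtain ⟨b, z, h1, h2, h3⟩ := hiter n
  have := hA' b (by linarith [hq _ h3]) z
  linarith

end IsSolution

/-! ### Choice of the decay rate and conclusion. -/

lemma UtilityAssumption.asymptoticRRA_nonneg {u : ℝ → EReal} (hu : UtilityAssumption u)
    (hRRA : BoundedRelativeRiskAversion u) : 0 ≤ asymptoticRRA u :=
  le_limsup_of_frequently_le
    ((eventually_gt_atTop 0).mono fun _ hx => hu.relativeRiskAversion_nonneg hx).frequently hRRA

/-- A propensity below `upperPropensity β R γ` leaves room for a decay rate `lam` of consumption
that is too slow for relative risk aversion slightly above `γ`. -/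
lemma exists_decay_rate {β R γ m : ℝ} (hβ : 0 < β) (hR : 1 ≤ R) (hβR : β * R < 1) (hγ : 0 ≤ γ)
    (hm : m < upperPropensity β R γ) :
    ∃ lam, 0 < lam ∧ lam < R * (1 - m) ∧ ∃ γ', γ < γ' ∧ β * R < lam ^ γ' := by
  have hR0 : 0 < R := by linarith
  have hq : 0 < β * R := by positivity
  obtain ⟨lam, h0, h1, h2⟩ : ∃ lam, 0 < lam ∧ lam < R * (1 - m) ∧ β * R < lam ^ γ := by
    rw [upperPropensity] at hm
    split_ifs at hm with hγ0
    · obtain ⟨lam, h0, h1⟩ := exists_between (show 0 < R * (1 - m) from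
        mul_pos hR0 (by linarith))
      exact ⟨lam, h0, h1, by simpa [hγ0] using hβR⟩
    · have hγ' : 0 < γ := lt_of_le_of_ne hγ (Ne.symm hγ0)
      have e : R * (β ^ (1 / γ) * R ^ (1 / γ - 1)) = (β * R) ^ (1 / γ) := by
        rw [Real.mul_rpow hβ.le hR0.le, Real.rpow_sub_one hR0.ne']
        field_simp
      obtain ⟨lam, h0, h1⟩ := exists_between (show (β * R) ^ (1 / γ) < R * (1 - m) by
        rw [← e]
        exact mul_lt_mul_of_pos_left (by linarith) hR0)
      have hp : 0 < (β * R) ^ (1 / γ) := Real.rpow_pos_of_pos hq _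
      refine ⟨lam, hp.trans h0, h1, ?_⟩
      have := Real.rpow_lt_rpow hp.le h0 hγ'
      rwa [← Real.rpow_mul hq.le, one_div_mul_cancel hγ0, Real.rpow_one] at this
  -- A limsup bounds risk aversion eventually only by numbers above it, so `γ` is raised slightly,
  -- using continuity in the exponent.
  have hc : Tendsto (fun g : ℝ => lam ^ g) (𝓝[>] γ) (𝓝 (lam ^ γ)) :=
    (Real.continuousAt_const_rpow h0.ne').tendsto.mono_left nhdsWithin_le_nhds
  obtain ⟨γ', h3, h4⟩ := ((hc.eventually_const_lt h2).and eventually_mem_nhdsWithin).exists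
  exact ⟨lam, h0, h1, γ', h4, h3⟩

end IncomeFluctuation
end

theorem proposition2 {Z : Type*} [MeasurableSpace Z]
    (u : ℝ → EReal) (β R : ℝ) (κ : Kernel Z Z) [IsMarkovKernel κ] (y : Z → ℝ)
    (hu : IncomeFluctuation.UtilityAssumption u)
    (hy : IncomeFluctuation.IncomeAssumption κ y)
    (hRRA : IncomeFluctuation.BoundedRelativeRiskAversion u)
    (hβ : 0 < β) (hR : 1 ≤ R) (hβR : R < 1 / β)
    (c : ℝ → Z → ℝ) (hc : IncomeFluctuation.IsOptimalPolicy u β R κ y c)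
    (hunif : R = 1 → ∃ a : ℝ, 0 < a ∧ ∃ ε : ℝ, 0 < ε ∧ ∀ z, ε ≤ c a z) :
    ∀ m ∈ Set.Ioo (1 - 1 / R)
        (IncomeFluctuation.upperPropensity β R (IncomeFluctuation.asymptoticRRA u)),
      ∃ A : ℝ, 0 ≤ A ∧ ∀ a : ℝ, A ≤ a → ∀ z : Z, m * a ≤ c a z := by
  rintro m ⟨hm1, hm2⟩
  have hR0 : 0 < R := by linarith
  have hm0 : 0 < m := lt_of_le_of_lt (sub_nonneg.2 ((div_le_one hR0).2 hR)) hm1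
  have hq : β * R < 1 := by rwa [lt_div_iff₀ hβ, mul_comm] at hβR
  have h : IncomeFluctuation.IsSolution u β R κ y c := ⟨hu, hy, hβ, hR, hq, hc⟩
  obtain ⟨lam, hl0, hlm, γ, hγ, hlγ⟩ := IncomeFluctuation.exists_decay_rate hβ hR hq
    (hu.asymptoticRRA_nonneg hRRA) hm2
  have hl1 : lam < 1 := by
    have e : R * (1 - 1 / R) = R - 1 := by field_simp
    nlinarith [mul_lt_mul_of_pos_left hm1 hR0]
  obtain ⟨x₀, hx₀⟩ := eventually_atTop.1 (eventually_lt_of_limsup_lt hγ hRRA)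
  obtain ⟨a₀, ha₀, ε, hε, hlow⟩ : ∃ a : ℝ, 0 < a ∧ ∃ ε : ℝ, 0 < ε ∧ ∀ z, ε ≤ c a z := by
    rcases hR.eq_or_lt with e | hlt
    · exact hunif e.symm
    · exact h.exists_uniform_lower_bound_of_one_lt hlt
  obtain ⟨A, hA0, hA⟩ := h.lt_of_le_sub ha₀ hε hlow hl0 hl1 hlγ
    (x₀ := max x₀ 1) (by positivity) (fun x hx => (hx₀ x ((le_max_left _ _).trans hx)).le)
  have hlR : 0 < 1 - lam / R := by
    rw [sub_pos, div_lt_one hR0]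
    linarith
  have hK : 0 < 1 - m / (1 - lam / R) := by
    rw [sub_pos, div_lt_one hlR]
    have : lam / R < 1 - m := by rwa [div_lt_iff₀' hR0]
    linarith
  -- The threshold solves `a - m a / (1 - lam / R) = A`.
  refine ⟨A / (1 - m / (1 - lam / R)), by positivity, fun a ha z => (hA a (m * a) z (mul_pos hm0 ((div_pos hA0 hK).trans_le ha)) ?_).le⟩
  rw [div_le_iff₀ hK] at ha
  refine ha.trans_eq ?_
  ring
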